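/- Let $k$ be a finite field and let $\mathcal A$ be an essentially small abelian $k$-linear category which is finitary, i.e. $\dim_k\operatorname{Hom}(M,N)<\infty$ and $\dim_k\operatorname{Ext}^1(M,N)<\infty$ for all objects $M,N$, and hereditary, i.e. $\operatorname{Ext}^p(M,N)=0$ for all objects $M,N$ and all $p\ge 2$. Let $\operatorname{Iso}(\mathcal A)$ be the set of isomorphism classes of objects of $\mathcal A$. For objects $A,B,C$ put $a_A=|\operatorname{Aut}(A)|$, and let $g^C_{AB}$ (the Hall number) be the number of subobjects $S$ of $C$ such that $S\cong B$ and $C/S\cong A$. These numbers are finite and depend only on isomorphism classes. Theorem (Green's formula). For all objects $A,B,A',B'$ of $\mathcal A$, each of the following two sums has only finitely many nonzero terms, and $$a_Aa_Ba_{A'}a_{B'}\sum_{C\in\operatorname{Iso}(\mathcal A)} g^C_{AB}\,g^C_{A'B'}\,\frac1{a_C}=\sum_{X,Y,X',Y'\in\operatorname{Iso}(\mathcal A)}\frac{|\operatorname{Ext}^1(X,Y')|}{|\operatorname{Hom}(X,Y')|}\,g^A_{XX'}\,g^B_{YY'}\,g^{A'}_{XY}\,g^{B'}_{X'Y'}\,a_Xa_Ya_{X'}a_{Y'}.$$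 -/

import Mathlib

open CategoryTheory CategoryTheory.Limits

universe w w₀ v u

namespace HallAlgebra

/-- An abelian category is hereditary if its Yoneda Ext groups vanish in all degrees `≥ 2`. -/
class Hereditary (𝒜 : Type u) [Category.{v} 𝒜] [Abelian 𝒜] [HasExt.{w} 𝒜] : Prop where
  ext_subsingleton : ∀ (M N : 𝒜) (n : ℕ), 2 ≤ n → Subsingleton (Abelian.Ext.{w} M N n)

/-- A `k`-linear abelian category is finitary if all `Hom` and `Ext¹` spaces are finite
dimensional over `k`. -/
class Finitary (k : Type*) [Field k] (𝒜 : Type u) [Category.{v} 𝒜] [Abelian 𝒜]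
    [Linear k 𝒜] [HasExt.{w} 𝒜] : Prop where
  finite_hom : ∀ M N : 𝒜, Module.Finite k (M ⟶ N)
  finite_ext : ∀ M N : 𝒜, Module.Finite k (Abelian.Ext.{w} M N 1)

/-- The set of isomorphism classes of objects. -/
abbrev IsoClass (𝒜 : Type u) [Category.{v} 𝒜] : Type u := Quotient (isIsomorphicSetoid 𝒜)

/-- A representative of an isomorphism class (all the quantities below depend only on the
isomorphism classes of the objects, so the choice is immaterial). -/
noncomputable abbrev IsoClass.rep {𝒜 : Type u} [Category.{v} 𝒜] (x : IsoClass 𝒜) : 𝒜 :=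
  Quotient.out x

/-- `a_A = |Aut A|`. -/
noncomputable def autCard {𝒜 : Type u} [Category.{v} 𝒜] (A : 𝒜) : ℕ := Nat.card (Aut A)

/-- The subobjects `S` of `C` with `S ≅ B` and `C / S ≅ A`. -/
def hallSet {𝒜 : Type u} [Category.{v} 𝒜] [Abelian 𝒜] (A B C : 𝒜) : Set (Subobject C) :=
  {S | Nonempty ((S : 𝒜) ≅ B) ∧ Nonempty (cokernel S.arrow ≅ A)}

/-- The Hall number `g^C_{AB}`: the number of subobjects `S` of `C` with `S ≅ B` and
`C / S ≅ A`. -/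
noncomputable def hallNumber {𝒜 : Type u} [Category.{v} 𝒜] [Abelian 𝒜] (A B C : 𝒜) : ℕ :=
  (hallSet A B C).ncard

/-- Hall numbers count finite sets whenever the `Hom` sets are finite. -/
theorem hallSet_finite {𝒜 : Type u} [Category.{v} 𝒜] [Abelian 𝒜] (A B C : 𝒜)
    [Finite (B ⟶ C)] : (hallSet A B C).Finite := by
  refine (Set.finite_range (fun f : B ⟶ C => imageSubobject f)).subset ?_
  rintro S ⟨⟨e⟩, -⟩
  refine ⟨e.inv ≫ S.arrow, ?_⟩
  change imageSubobject (e.inv ≫ S.arrow) = S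
  rw [imageSubobject_iso_comp, imageSubobject_mono, Subobject.mk_arrow]

/-- The term of the left-hand sum of Green's formula at the isomorphism class of `C`. -/
noncomputable def greenLeftTerm {𝒜 : Type u} [Category.{v} 𝒜] [Abelian 𝒜]
    (A B A' B' C : 𝒜) : ℚ :=
  (hallNumber A B C : ℚ) * (hallNumber A' B' C : ℚ) * (1 / (autCard C : ℚ))

/-- The term of the right-hand sum of Green's formula at the isomorphism classes of
`X, Y, X', Y'`. -/
noncomputable def greenRightTerm {𝒜 : Type u} [Category.{v} 𝒜] [Abelian 𝒜] [HasExt.{w} 𝒜]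
    (A B A' B' X Y X' Y' : 𝒜) : ℚ :=
  ((Nat.card (Abelian.Ext.{w} X Y' 1) : ℚ) / (Nat.card (X ⟶ Y') : ℚ)) *
    (hallNumber X X' A : ℚ) * (hallNumber Y Y' B : ℚ) *
    (hallNumber X Y A' : ℚ) * (hallNumber X' Y' B' : ℚ) *
    (autCard X : ℚ) * (autCard Y : ℚ) * (autCard X' : ℚ) * (autCard Y' : ℚ)

end HallAlgebra

/-! Green's formula is a weighted double count of three by three diagrams with exact rows and
columns. By `card_ses`, Hall numbers times automorphism orders count short exact sequences. The left
side therefore counts crosses at `C` with weight `1 / a_C`. The right side counts frames with weight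
`|Ext¹(X,Y')| / |Hom(X,Y')|`, divided by the automorphism orders of the corners.

A cross determines its frame up to unique isomorphisms of the corners, so its frames have total
weight one (`Cross.sum_card_compat`). For a fixed frame, put `S = B ⊔_{Y'} B'`, `T = A ×_X A'` and
`I = X' ⊞ Y`. A compatible cross is the same as a factorization of `S ⟶ I ⟶ T` through `C` with `Y'
⟶ C ⟶ T` short exact (`Frame.card_compat`). Such factorizations lie over the classes in `Ext¹(T,Y')`
that restrict to the class of `S` in `Ext¹(I,Y')`. Since `Ext²(X,Y') = 0`, such classes exist, and
the long exact sequence counts them (`card_ext_fiber`). The weighted total is `|Ext¹(X,Y')| /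
|Hom(X,Y')|` (`Frame.sum_card_compat`). -/

namespace HallAlgebra

/-! ### Short exact sequences and their classes in `Ext¹`. -/

section ShortExactSequences

variable {𝒜 : Type u} [Category.{v} 𝒜] [Abelian 𝒜]

/-- The pair `K ⟶ E ⟶ Q` is a short exact sequence. -/
def IsSES {K E Q : 𝒜} (i : K ⟶ E) (p : E ⟶ Q) : Prop :=
  ∃ w : i ≫ p = 0, (ShortComplex.mk i p w).ShortExact

namespace IsSES

variable {K E Q : 𝒜} {i : K ⟶ E} {p : E ⟶ Q}

theorem zero (h : IsSES i p) : i ≫ p = 0 := h.1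

theorem shortExact (h : IsSES i p) : (ShortComplex.mk i p h.zero).ShortExact := h.2

theorem mono (h : IsSES i p) : Mono i := h.2.mono_f

theorem epi (h : IsSES i p) : Epi p := h.2.epi_g

theorem exists_lift (h : IsSES i p) {W : 𝒜} (t : W ⟶ E) (ht : t ≫ p = 0) :
    ∃ s : W ⟶ K, s ≫ i = t :=
  have := h.mono
  ⟨h.2.exact.lift t ht, h.2.exact.lift_f t ht⟩

theorem exists_desc (h : IsSES i p) {W : 𝒜} (t : E ⟶ W) (ht : i ≫ t = 0) :
    ∃ s : Q ⟶ W, p ≫ s = t :=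
  have := h.epi
  ⟨h.2.exact.desc t ht, h.2.exact.g_desc t ht⟩

theorem of_lift (w : i ≫ p = 0) [Mono i] [Epi p]
    (h : ∀ {W : 𝒜} (t : W ⟶ E), t ≫ p = 0 → ∃ s : W ⟶ K, s ≫ i = t) : IsSES i p := by
  refine ⟨w, ?_⟩
  have hex : (ShortComplex.mk i p w).Exact := by
    refine ShortComplex.exact_of_f_is_kernel _
      (KernelFork.IsLimit.ofι' _ _ fun {W} t ht => ⟨(h t ht).choose, (h t ht).choose_spec⟩)
  exact { exact := hex, mono_f := ‹_›, epi_g := ‹_› }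

theorem of_desc (w : i ≫ p = 0) [Mono i] [Epi p]
    (h : ∀ {W : 𝒜} (t : E ⟶ W), i ≫ t = 0 → ∃ s : Q ⟶ W, p ≫ s = t) : IsSES i p := by
  refine ⟨w, ?_⟩
  have hex : (ShortComplex.mk i p w).Exact := by
    refine ShortComplex.exact_of_g_is_cokernel _
      (CokernelCofork.IsColimit.ofπ' _ _ fun {W} t ht => ⟨(h t ht).choose, (h t ht).choose_spec⟩)
  exact { exact := hex, mono_f := ‹_›, epi_g := ‹_› }

theorem of_refinements (w : i ≫ p = 0) [Mono i] [Epi p]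
    (h : ∀ {W : 𝒜} (t : W ⟶ E), t ≫ p = 0 →
      ∃ (V : 𝒜) (π : V ⟶ W) (_ : Epi π) (s : V ⟶ K), π ≫ t = s ≫ i) : IsSES i p := by
  refine ⟨w, ?_⟩
  have hex : (ShortComplex.mk i p w).Exact := by
    rw [ShortComplex.exact_iff_exact_up_to_refinements]
    exact fun W t ht => h t ht
  exact { exact := hex, mono_f := ‹_›, epi_g := ‹_› }

theorem kernel_cokernel {M N : 𝒜} (f : M ⟶ N) [Mono f] : IsSES f (cokernel.π f) :=
  of_desc (cokernel.condition f) fun t ht => ⟨cokernel.desc f t ht, cokernel.π_desc f t ht⟩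

theorem congr_iso (h : IsSES i p) {K' E' Q' : 𝒜} (a : K' ≅ K) (b : E ≅ E') (c : Q ≅ Q') :
    IsSES (a.hom ≫ i ≫ b.hom) (b.inv ≫ p ≫ c.hom) := by
  have := h.mono
  have := h.epi
  refine of_lift (by simp [reassoc_of% h.zero]) fun t ht => ?_
  obtain ⟨s, hs⟩ := h.exists_lift (t ≫ b.inv) (by
    rw [← cancel_mono c.hom]; simpa using ht)
  exact ⟨s ≫ a.inv, by simp [reassoc_of% hs]⟩

/-- Two short exact sequences with the same outer terms map to each other compatibly with
the identity on the kernel as soon as the Yoneda class of the second restricts to that of the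
first. -/
theorem exists_hom_iff [HasExt.{w} 𝒜] {S I C T : 𝒜} {κ : K ⟶ S} {p : S ⟶ I} {i : K ⟶ C}
    {e : C ⟶ T} (h : IsSES κ p) (h' : IsSES i e) (j : I ⟶ T) :
    (∃ m : S ⟶ C, κ ≫ m = i ∧ m ≫ e = p ≫ j) ↔
      (Abelian.Ext.mk₀ j).comp h'.shortExact.extClass (zero_add 1) = h.shortExact.extClass := by
  constructor
  · rintro ⟨m, hm, hm'⟩
    have := h.shortExact.extClass_naturality h'.shortExact
      { τ₁ := 𝟙 K, τ₂ := m, τ₃ := j, comm₁₂ := by simp [hm], comm₂₃ := hm' }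
    simpa using this.symm
  · intro hj
    -- The class of `h` is pulled back from that of `h'`, which `i` kills; hence `i` extends along
    -- `κ`.
    obtain ⟨x, hx⟩ := Abelian.Ext.contravariant_sequence_exact₁ h.shortExact C
      (Abelian.Ext.mk₀ i) (n₁ := 1) rfl (by
        have := h'.shortExact.extClass_comp
        rw [← hj, Abelian.Ext.comp_assoc (a₂₃ := 1) _ _ _ _ (add_zero 1) (by lia), this,
          Abelian.Ext.comp_zero])
    obtain ⟨φ, rfl⟩ := Abelian.Ext.addEquiv₀.symm.surjective x
    have hφ : κ ≫ φ = i := by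
      apply Abelian.Ext.addEquiv₀.symm.injective
      simpa using hx
    obtain ⟨ψ, hψ⟩ := h.exists_desc (φ ≫ e) (by rw [reassoc_of% hφ, h'.zero])
    have hψ' := h.shortExact.extClass_naturality h'.shortExact
      { τ₁ := 𝟙 K, τ₂ := φ, τ₃ := ψ, comm₁₂ := by simp [hφ], comm₂₃ := hψ.symm }
    simp only [Abelian.Ext.comp_mk₀_id, ← hj] at hψ'
    -- The extension `φ` induces `ψ`, possibly different from `j`. Both pull the class of `h'` back
    -- to that of `h`, so `ψ - j` lifts to `C`, and subtracting the lift corrects `φ`.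
    obtain ⟨y, hy⟩ := Abelian.Ext.covariant_sequence_exact₃ I h'.shortExact
      (Abelian.Ext.mk₀ (ψ - j)) (n₁ := 1) rfl (by
        rw [sub_eq_add_neg, Abelian.Ext.mk₀_add, Abelian.Ext.mk₀_neg, Abelian.Ext.add_comp,
          Abelian.Ext.neg_comp, ← hψ']
        simp)
    obtain ⟨t, rfl⟩ := Abelian.Ext.addEquiv₀.symm.surjective y
    have ht : t ≫ e = ψ - j := by
      apply Abelian.Ext.addEquiv₀.symm.injective
      simpa using hy
    refine ⟨φ - p ≫ t, ?_, ?_⟩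
    · simp [hφ, reassoc_of% h.zero]
    · simp [Preadditive.sub_comp, ht, Preadditive.comp_sub, hψ]

/-- The middle five lemma for morphisms of short exact sequences that are identities on the
outer terms. -/
theorem isIso_of_comp {E' : 𝒜} {i' : K ⟶ E'} {p' : E' ⟶ Q} (h : IsSES i p) (h' : IsSES i' p')
    (m : E ⟶ E') (h₁ : i ≫ m = i') (h₂ : m ≫ p' = p) : IsIso m := by
  have : Mono m := Preadditive.mono_of_cancel_zero _ fun t ht => by
    obtain ⟨s, rfl⟩ := h.exists_lift t (by rw [← h₂, reassoc_of% ht, zero_comp])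
    rw [Category.assoc, h₁] at ht
    have := h'.mono
    rw [zero_of_comp_mono _ ht, zero_comp]
  have : Epi m := Preadditive.epi_of_cancel_zero _ fun t ht => by
    obtain ⟨s, rfl⟩ := h'.exists_desc t (by rw [← h₁, Category.assoc, ht, comp_zero])
    rw [reassoc_of% h₂] at ht
    have := h.epi
    rw [zero_of_epi_comp _ ht, comp_zero]
  exact isIso_of_mono_of_epi m

end IsSES

open Abelian DerivedCategory Pretriangulated in
/-- Every class in `Ext¹` is the class of a short exact sequence. -/
theorem exists_isSES_extClass_eq [HasExt.{w} 𝒜] {K T : 𝒜} (ξ : Ext.{w} T K 1) :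
    ∃ (C : 𝒜) (i : K ⟶ C) (e : C ⟶ T) (h : IsSES i e), h.shortExact.extClass = ξ := by
  let _ := HasDerivedCategory.standard 𝒜
  let s := singleFunctor 𝒜 0
  -- The outer terms of this triangle sit in degree zero, so the middle term does too and comes from
  -- an object of `𝒜`.
  obtain ⟨Z, f, g, hT⟩ := distinguished_cocone_triangle₂ (X := s.obj K) (Z := s.obj T) ξ.hom
  have hge : Z.IsGE 0 := TStructure.t.isGE₂ _ hT 0 (inferInstanceAs ((s.obj K).IsGE 0))
    (inferInstanceAs ((s.obj T).IsGE 0))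
  have hle : Z.IsLE 0 := TStructure.t.isLE₂ _ hT 0 (inferInstanceAs ((s.obj K).IsLE 0))
    (inferInstanceAs ((s.obj T).IsLE 0))
  obtain ⟨C, ⟨ε⟩⟩ := exists_iso_singleFunctor_obj_of_isGE_of_isLE Z 0
  obtain ⟨i, hi⟩ := s.map_surjective (f ≫ ε.hom)
  obtain ⟨e, he⟩ := s.map_surjective (ε.inv ≫ g)
  have hT' : Triangle.mk (s.map i) (s.map e) ξ.hom ∈ distTriang (DerivedCategory 𝒜) := by
    refine isomorphic_distinguished _ hT _
      (Triangle.isoMk _ _ (Iso.refl _) ε.symm (Iso.refl _) ?_ ?_ ?_)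
    · change s.map i ≫ ε.inv = 𝟙 _ ≫ f
      simp [hi]
    · change s.map e ≫ 𝟙 _ = ε.inv ≫ g
      simp [he]
    · change ξ.hom ≫ (shiftFunctor (DerivedCategory 𝒜) (1 : ℤ)).map (𝟙 _) = 𝟙 _ ≫ ξ.hom
      simp
  have w : i ≫ e = 0 := s.map_injective (by
    have := comp_distTriang_mor_zero₁₂ _ hT'
    change s.map i ≫ s.map e = 0 at this
    rw [s.map_comp, this, s.map_zero])
  have hzero {M N : 𝒜} (a : M ⟶ N) (h : s.map a = 0) : a = 0 :=
    s.map_injective (h.trans (s.map_zero _ _).symm)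
  -- A map killed by `i` factors through `T[-1]`, and there are no nonzero maps from `W` to `T[-1]`.
  -- The proof of `Epi e` is dual.
  have : Mono i := Preadditive.mono_of_cancel_zero _ fun {W} t ht => hzero _ (by
    obtain ⟨r, hr⟩ := Triangle.coyoneda_exact₂ _ (inv_rot_of_distTriang _ hT') (s.map t) (by
      change s.map t ≫ s.map i = 0
      rw [← s.map_comp, ht, s.map_zero])
    have : TStructure.t.IsLE (s.obj W) 0 := inferInstanceAs ((s.obj W).IsLE 0)
    have : TStructure.t.IsGE (s.obj T) 0 := inferInstanceAs ((s.obj T).IsGE 0)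
    have hr0 : r = 0 := TStructure.t.zero_of_isLE_of_isGE r 0 1 (by lia) inferInstance
      (TStructure.t.isGE_shift (s.obj T) 0 (-1) 1)
    rw [hr, hr0, zero_comp]
    rfl)
  have : Epi e := Preadditive.epi_of_cancel_zero _ fun {W} t ht => hzero _ (by
    obtain ⟨r, hr⟩ := Triangle.yoneda_exact₃ _ hT' (s.map t) (by
      change s.map e ≫ s.map t = 0
      rw [← s.map_comp, ht, s.map_zero])
    have : TStructure.t.IsLE (s.obj K) 0 := inferInstanceAs ((s.obj K).IsLE 0)
    have : TStructure.t.IsGE (s.obj W) 0 := inferInstanceAs ((s.obj W).IsGE 0)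
    have hr0 : r = 0 := TStructure.t.zero_of_isLE_of_isGE r (-1) 0 (by lia)
      (TStructure.t.isLE_shift (s.obj K) 0 1 (-1)) inferInstance
    rw [hr, hr0, comp_zero]
    rfl)
  have h : IsSES i e := IsSES.of_lift w fun {W} t ht => by
    obtain ⟨r, hr⟩ := Triangle.coyoneda_exact₂ _ hT' (s.map t) (by
      change s.map t ≫ s.map e = 0
      rw [← s.map_comp, ht, s.map_zero])
    obtain ⟨r, rfl⟩ := s.map_surjective r
    refine ⟨r, s.map_injective ?_⟩
    rw [s.map_comp]
    exact hr.symm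
  refine ⟨C, i, e, h, ?_⟩
  ext
  rw [ShortComplex.ShortExact.extClass_hom]
  -- The identities on `K` and `C` extend to a morphism of triangles. Its third component is the
  -- identity because `e` is epi, so the connecting maps agree.
  obtain ⟨ψ, hψ, hψ'⟩ := complete_distinguished_triangle_morphism _ _
    h.shortExact.singleTriangle_distinguished hT' (𝟙 (s.obj K)) (𝟙 (s.obj C))
      ((Category.comp_id _).trans (Category.id_comp _).symm)
  obtain ⟨ψ, rfl⟩ : ∃ ψ' : T ⟶ T, s.map ψ' = ψ := s.map_surjective ψ
  have hψ1 : ψ = 𝟙 T := by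
    rw [← cancel_epi e]
    apply s.map_injective
    rw [s.map_comp, Category.comp_id]
    exact hψ.trans (Category.id_comp _)
  have h₁ : h.shortExact.singleδ ≫ (shiftFunctor (DerivedCategory 𝒜) (1 : ℤ)).map (𝟙 (s.obj K)) =
      h.shortExact.singleδ := by
    rw [CategoryTheory.Functor.map_id]
    exact Category.comp_id _
  have h₂ : s.map ψ ≫ ξ.hom = ξ.hom := by
    rw [hψ1, s.map_id, Category.id_comp]
  exact h₁.symm.trans (hψ'.trans h₂)

end ShortExactSequences

/-! ### Orders of groups in exact sequences. -/

theorem card_eq_card_range_mul_card_range {A B C : Type*} [AddCommGroup A] [AddCommGroup B]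
    [AddCommGroup C] (f : A →+ B) (g : B →+ C) (h : Function.Exact f g) :
    Nat.card B = Nat.card f.range * Nat.card g.range := by
  rw [AddSubgroup.card_eq_card_quotient_mul_card_addSubgroup g.ker, mul_comm,
    Nat.card_congr (QuotientAddGroup.quotientKerEquivRange g).toEquiv,
    AddMonoidHom.exact_iff.1 h]

/-- The fibre is a coset of the range of `f₄`. Each of `G₂`, `G₃`, `G₄` has order the product of two
consecutive ranges, and the product telescopes. -/
theorem card_fiber_mul_of_exact {G₁ G₂ G₃ G₄ G₅ G₆ : Type*} [AddCommGroup G₁] [AddCommGroup G₂]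
    [AddCommGroup G₃] [AddCommGroup G₄] [AddCommGroup G₅] [AddCommGroup G₆]
    [Finite G₁] [Finite G₂] [Finite G₃] [Finite G₄] [Finite G₅]
    (f₁ : G₁ →+ G₂) (f₂ : G₂ →+ G₃) (f₃ : G₃ →+ G₄) (f₄ : G₄ →+ G₅) (f₅ : G₅ →+ G₆)
    (h₁ : Function.Injective f₁) (h₂ : Function.Exact f₁ f₂) (h₃ : Function.Exact f₂ f₃)
    (h₄ : Function.Exact f₃ f₄) (h₅ : Function.Exact f₄ f₅) (h₆ : Function.Surjective f₅)
    (σ : G₆) :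
    Nat.card {x : G₅ // f₅ x = σ} * Nat.card G₁ * Nat.card G₃ = Nat.card G₄ * Nat.card G₂ := by
  obtain ⟨y, rfl⟩ := h₆ σ
  have e₁ : Nat.card {x : G₅ // f₅ x = f₅ y} = Nat.card f₄.range := by
    rw [← AddMonoidHom.exact_iff.1 h₅]
    refine Nat.card_congr ((Equiv.subRight y).subtypeEquiv fun x => ?_)
    simp [AddMonoidHom.mem_ker, sub_eq_zero]
  have e₂ : Nat.card G₁ = Nat.card f₁.range := Nat.card_congr (Equiv.ofInjective f₁ h₁)
  rw [e₁, e₂, card_eq_card_range_mul_card_range f₁ f₂ h₂,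
    card_eq_card_range_mul_card_range f₂ f₃ h₃, card_eq_card_range_mul_card_range f₃ f₄ h₄]
  ring

/-! ### Hall numbers as counts of short exact sequences. -/

section Counting

variable {𝒜 : Type u} [Category.{v} 𝒜] [Abelian 𝒜]

namespace IsSES

variable {K E Q : 𝒜} {i : K ⟶ E} {p : E ⟶ Q}

theorem exists_iso_right (h : IsSES i p) {Q' : 𝒜} {p' : E ⟶ Q'} (h' : IsSES i p') :
    ∃ c : Q ≅ Q', p ≫ c.hom = p' := by
  obtain ⟨c, hc⟩ := h.exists_desc p' h'.zero
  obtain ⟨d, hd⟩ := h'.exists_desc p h.zero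
  have := h.epi
  have := h'.epi
  exact ⟨⟨c, d, by rw [← cancel_epi p]; simp [reassoc_of% hc, hd],
    by rw [← cancel_epi p']; simp [reassoc_of% hd, hc]⟩, hc⟩

theorem exists_iso_left (h : IsSES i p) {K' : 𝒜} {i' : K' ⟶ E} (h' : IsSES i' p) :
    ∃ c : K' ≅ K, c.hom ≫ i = i' := by
  obtain ⟨c, hc⟩ := h.exists_lift i' h'.zero
  obtain ⟨d, hd⟩ := h'.exists_lift i h.zero
  have := h.mono
  have := h'.mono
  exact ⟨⟨c, d, by rw [← cancel_mono i']; simp [hc, hd],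
    by rw [← cancel_mono i]; simp [hd, hc]⟩, hc⟩

end IsSES

/-- The short exact sequences with given objects. -/
def SES (K E Q : 𝒜) : Type v := {x : (K ⟶ E) × (E ⟶ Q) // IsSES x.1 x.2}

instance [∀ M N : 𝒜, Finite (M ⟶ N)] (K E Q : 𝒜) : Finite (SES K E Q) :=
  inferInstanceAs (Finite {x : (K ⟶ E) × (E ⟶ Q) // IsSES x.1 x.2})

omit [Abelian 𝒜] in
theorem autCard_pos [∀ M N : 𝒜, Finite (M ⟶ N)] (M : 𝒜) : 0 < autCard M :=
  have : Finite (Aut M) := Finite.of_injective (fun e : M ≅ M => e.hom) fun _ _ h => Iso.ext h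
  Nat.card_pos

omit [Abelian 𝒜] in
theorem IsoClass.nonempty_rep_iso (C : 𝒜) : Nonempty (IsoClass.rep (⟦C⟧ : IsoClass 𝒜) ≅ C) :=
  Quotient.exact (Quotient.out_eq (⟦C⟧ : IsoClass 𝒜))

omit [Abelian 𝒜] in
theorem IsoClass.mk_eq (c : IsoClass 𝒜) {C : 𝒜} (φ : C ≅ c.rep) : ⟦C⟧ = c :=
  (Quotient.sound ⟨φ⟩ : (⟦C⟧ : IsoClass 𝒜) = ⟦c.rep⟧).trans (Quotient.out_eq c)

/-- A sequence amounts to its image subobject with identifications of the subobject with `B` and of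
the quotient with `A`. Relative to the chosen `eB` and `eA`, these run through `Aut B` and `Aut A`.
-/
theorem card_ses (A B C : 𝒜) :
    Nat.card (SES B C A) = hallNumber A B C * (autCard A * autCard B) := by
  have eB (S : hallSet A B C) : ((S : Subobject C) : 𝒜) ≅ B := S.2.1.some
  have eA (S : hallSet A B C) : cokernel (S : Subobject C).arrow ≅ A := S.2.2.some
  change _ = _ * (Nat.card (A ≅ A) * Nat.card (B ≅ B))
  rw [hallNumber, ← Nat.card_coe_set_eq, ← Nat.card_prod, ← Nat.card_prod]
  symm
  refine Nat.card_congr (Equiv.ofBijective (fun x => ⟨(x.2.2.hom ≫ (eB x.1).inv ≫ x.1.1.arrow,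
    cokernel.π x.1.1.arrow ≫ (eA x.1).hom ≫ x.2.1.hom), ?_⟩) ⟨?_, ?_⟩)
  · simpa using (IsSES.kernel_cokernel x.1.1.arrow).congr_iso (x.2.2 ≪≫ (eB x.1).symm)
      (Iso.refl _) (eA x.1 ≪≫ x.2.1)
  · rintro ⟨S, α, β⟩ ⟨S', α', β'⟩ h
    have h₁ := congrArg (fun s : SES B C A => s.1.1) h
    have h₂ := congrArg (fun s : SES B C A => s.1.2) h
    have hmk (S : hallSet A B C) (β : B ≅ B) :
        Subobject.mk (β.hom ≫ (eB S).inv ≫ S.1.arrow) = S.1 := by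
      conv_rhs => rw [← Subobject.mk_arrow S.1]
      exact Subobject.mk_eq_mk_of_comm _ _ (β ≪≫ (eB S).symm) (by simp)
    obtain rfl : S = S' := by
      apply Subtype.ext
      rw [← hmk S β, ← hmk S' β']
      congr 1
    simp only [← Category.assoc, cancel_mono] at h₁
    simp only [cancel_epi] at h₂
    rw [Iso.ext h₁, Iso.ext h₂]
  · rintro ⟨⟨i, p⟩, hs⟩
    have := hs.mono
    have hS := (IsSES.kernel_cokernel (Subobject.mk i).arrow)
    have hp : IsSES (Subobject.mk i).arrow p := by
      simpa using hs.congr_iso (Subobject.underlyingIso i) (Iso.refl _) (Iso.refl _)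
    obtain ⟨c, hc⟩ := hS.exists_iso_right hp
    set S : hallSet A B C := ⟨Subobject.mk i, ⟨Subobject.underlyingIso i⟩, ⟨c⟩⟩
    refine ⟨⟨S, (eA S).symm ≪≫ c, (Subobject.underlyingIso i).symm ≪≫ eB S⟩,
      Subtype.ext (Prod.ext ?_ ?_)⟩
    · simp [S]
    · simpa [S] using hc

end Counting

/-! ### Counting factorizations through an extension. -/

section Completions

variable {𝒜 : Type u} [Category.{v} 𝒜] [Abelian 𝒜] [HasExt.{w} 𝒜]

/-- The class in `Ext¹` of a short exact sequence. -/
noncomputable def SES.cls {K E Q : 𝒜} (s : SES K E Q) : Abelian.Ext.{w} Q K 1 :=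
  s.2.shortExact.extClass

/-- The factorizations of `S ⟶ I ⟶ T` through `C` for which `K ⟶ C ⟶ T` is short exact. -/
def Completion {K S I T : 𝒜} (κ : K ⟶ S) (p : S ⟶ I) (j : I ⟶ T) (C : 𝒜) : Type v :=
  {x : (S ⟶ C) × (C ⟶ T) // x.1 ≫ x.2 = p ≫ j ∧ IsSES (κ ≫ x.1) x.2}

/-- By `exists_hom_iff`, the listed sequences are those admitting a map `S ⟶ C`. Two such maps
differ by one that vanishes on `K` and lands in `K`, that is, by a unique map `I ⟶ K`. -/
theorem card_completion {K S I T : 𝒜} {κ : K ⟶ S} {p : S ⟶ I} (h : IsSES κ p) (j : I ⟶ T)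
    (C : 𝒜) :
    Nat.card (Completion κ p j C) =
      Nat.card {s : SES K C T // (Abelian.Ext.mk₀ j).comp (SES.cls.{w} s) (zero_add 1) =
        h.shortExact.extClass} * Nat.card (I ⟶ K) := by
  rw [← Nat.card_prod]
  symm
  choose m hm hm' using fun s : {s : SES K C T // (Abelian.Ext.mk₀ j).comp (SES.cls.{w} s)
    (zero_add 1) = h.shortExact.extClass} => (h.exists_hom_iff s.1.2 j).2 s.2
  have hp := h.epi
  refine Nat.card_congr (Equiv.ofBijective
    (fun x => ⟨(m x.1 + p ≫ x.2 ≫ x.1.1.1.1, x.1.1.1.2), ?_, ?_⟩) ⟨?_, ?_⟩)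
  · simp [hm', x.1.1.2.zero]
  · simpa [hm, reassoc_of% h.zero] using x.1.1.2
  · rintro ⟨⟨⟨⟨i, e⟩, hs⟩, hσ⟩, d⟩ ⟨⟨⟨⟨i', e'⟩, hs'⟩, hσ'⟩, d'⟩ hx
    have h₁ := congrArg (fun s : Completion κ p j C => s.1.1) hx
    obtain rfl : e = e' := congrArg (fun s : Completion κ p j C => s.1.2) hx
    have h₂ := congrArg (fun t => κ ≫ t) h₁
    simp only [Preadditive.comp_add, hm, reassoc_of% h.zero, zero_comp, add_zero] at h₂
    subst h₂
    have := hs.mono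
    simp only [add_right_inj, cancel_epi, cancel_mono] at h₁
    rw [h₁]
  · rintro ⟨⟨n, e⟩, hn, hs⟩
    obtain ⟨s, hs'⟩ : ∃ s : {s : SES K C T // (Abelian.Ext.mk₀ j).comp (SES.cls.{w} s)
        (zero_add 1) = h.shortExact.extClass}, s.1.1 = (κ ≫ n, e) :=
      ⟨⟨⟨(κ ≫ n, e), hs⟩, (h.exists_hom_iff hs j).1 ⟨n, rfl, hn⟩⟩, rfl⟩
    have h₁ := hm s
    have h₂ := hm' s
    rw [hs'] at h₁ h₂
    obtain ⟨x, hx⟩ := h.exists_desc (n - m s) (by simp [h₁])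
    obtain ⟨d, hd⟩ := hs.exists_lift x (by
      rw [← cancel_epi p, reassoc_of% hx]
      simp [hn, h₂])
    refine ⟨(s, d), Subtype.ext (Prod.ext ?_ ?_)⟩
    · change m s + p ≫ d ≫ s.1.1.1 = n
      rw [hs', hd, hx]
      abel
    · change s.1.1.2 = e
      rw [hs']

omit [HasExt 𝒜] in
theorem card_completion_id {K C C' T : 𝒜} {i : K ⟶ C} {e : C ⟶ T} (h : IsSES i e) :
    Nat.card (Completion i e (𝟙 T) C') = Nat.card (C ≅ C') := by
  symm
  refine Nat.card_congr (Equiv.ofBijective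
    (fun φ => ⟨(φ.hom, φ.inv ≫ e), by simp, ?_⟩) ⟨?_, ?_⟩)
  · simpa using h.congr_iso (Iso.refl _) φ (Iso.refl _)
  · intro φ φ' hφ
    exact Iso.ext (congrArg (fun s : Completion i e (𝟙 T) C' => s.1.1) hφ)
  · rintro ⟨⟨m, e'⟩, hm, hs⟩
    dsimp only at hm hs
    rw [Category.comp_id] at hm
    have := h.isIso_of_comp hs m rfl hm
    exact ⟨asIso m, Subtype.ext (Prod.ext rfl (by simp [← hm]))⟩

/-- Completions with `j = 𝟙 T` are counted in two ways. In effect, isomorphisms `C ≅ C'` act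
transitively on the sequences of one class, with stabilizer `Hom(T, K)`. -/
theorem SES.card_cls_mul {K C C' T : 𝒜} (s : SES K C T) :
    Nat.card {s' : SES K C' T // s'.cls = SES.cls.{w} s} * Nat.card (T ⟶ K) =
      Nat.card (C ≅ C') := by
  rw [← card_completion_id s.2, card_completion.{w} s.2]
  simp only [Abelian.Ext.mk₀_id_comp]
  rfl

variable [∀ M N : 𝒜, Finite (M ⟶ N)]

/-- Only the isomorphism class of the middle term of `ω` contributes, and its automorphism order
cancels. -/
theorem sum_card_cls_eq {K T : 𝒜} (ω : Abelian.Ext.{w} T K 1) (𝒮 : Finset (IsoClass 𝒜))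
    (h𝒮 : ∀ (C : 𝒜) (s : SES K C T), SES.cls.{w} s = ω → ⟦C⟧ ∈ 𝒮) :
    ∑ C ∈ 𝒮, (Nat.card {s : SES K C.rep T // s.cls = ω} : ℚ) / autCard C.rep =
      1 / Nat.card (T ⟶ K) := by
  obtain ⟨C, i, e, h, rfl⟩ := exists_isSES_extClass_eq ω
  set s : SES K C T := ⟨(i, e), h⟩
  have hs (C' : 𝒜) : (Nat.card {s' : SES K C' T // s'.cls = SES.cls.{w} s} : ℚ) =
      Nat.card (C ≅ C') / Nat.card (T ⟶ K) := by
    have : (Nat.card (T ⟶ K) : ℚ) ≠ 0 := by exact_mod_cast Nat.card_pos.ne'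
    rw [eq_div_iff this]
    exact_mod_cast SES.card_cls_mul s
  change ∑ C' ∈ 𝒮, (Nat.card {s' : SES K C'.rep T // s'.cls = s.cls} : ℚ) / autCard C'.rep = _
  simp only [hs]
  rw [Finset.sum_eq_single (⟦C⟧ : IsoClass 𝒜)]
  · obtain ⟨φ⟩ : Nonempty (IsoClass.rep (⟦C⟧ : IsoClass 𝒜) ≅ C) :=
      IsoClass.nonempty_rep_iso C
    have : Nat.card (C ≅ IsoClass.rep (⟦C⟧ : IsoClass 𝒜)) =
        autCard (IsoClass.rep (⟦C⟧ : IsoClass 𝒜)) :=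
      Nat.card_congr ⟨fun ψ => φ ≪≫ ψ, fun ψ => φ.symm ≪≫ ψ,
        fun _ => Iso.ext (φ.inv_hom_id_assoc _), fun _ => Iso.ext (φ.hom_inv_id_assoc _)⟩
    rw [this]
    have : (autCard (IsoClass.rep (⟦C⟧ : IsoClass 𝒜)) : ℚ) ≠ 0 := by
      exact_mod_cast (autCard_pos _).ne'
    field_simp
  · intro C' _ hC'
    have : IsEmpty (C ≅ IsoClass.rep C') := ⟨fun φ => hC' (IsoClass.mk_eq C' φ).symm⟩
    simp
  · intro hC
    exact (hC (h𝒮 C s rfl)).elim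

theorem sum_card_cls_mem {K T : 𝒜} [Finite (Abelian.Ext.{w} T K 1)]
    (P : Abelian.Ext.{w} T K 1 → Prop) (𝒮 : Finset (IsoClass 𝒜))
    (h𝒮 : ∀ (C : 𝒜) (s : SES K C T), P s.cls → ⟦C⟧ ∈ 𝒮) :
    ∑ C ∈ 𝒮, (Nat.card {s : SES K C.rep T // P s.cls} : ℚ) / autCard C.rep =
      (Nat.card {ω // P ω} : ℚ) / Nat.card (T ⟶ K) := by
  have := Fintype.ofFinite {ω // P ω}
  have key (C : 𝒜) : (Nat.card {s : SES K C T // P s.cls} : ℚ) =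
      ∑ ω : {ω // P ω}, (Nat.card {s : SES K C T // s.cls = ω.1} : ℚ) := by
    rw [← Nat.cast_sum, ← Nat.card_sigma]
    exact congrArg _ (Nat.card_congr
      (Equiv.sigmaSubtypeFiberEquivSubtype SES.cls fun _ => Iff.rfl).symm)
  simp only [key, Finset.sum_div]
  rw [Finset.sum_comm, Finset.sum_congr rfl (fun ω _ => sum_card_cls_eq ω.1 𝒮
    fun C s hs => h𝒮 C s (by rw [hs]; exact ω.2))]
  simp [div_eq_mul_inv]

theorem card_ext_fiber {I T Q : 𝒜} (K : 𝒜) [∀ M N : 𝒜, Finite (Abelian.Ext.{w} M N 1)]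
    [Subsingleton (Abelian.Ext.{w} Q K 2)]
    {j : I ⟶ T} {q : T ⟶ Q} (h : IsSES j q) (σ : Abelian.Ext.{w} I K 1) :
    Nat.card {ω : Abelian.Ext.{w} T K 1 // (Abelian.Ext.mk₀ j).comp ω (zero_add 1) = σ} *
      Nat.card (Q ⟶ K) * Nat.card (I ⟶ K) =
      Nat.card (Abelian.Ext.{w} Q K 1) * Nat.card (T ⟶ K) := by
  have e (M : 𝒜) : Nat.card (M ⟶ K) = Nat.card (Abelian.Ext.{w} M K 0) :=
    Nat.card_congr Abelian.Ext.addEquiv₀.symm.toEquiv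
  have (M : 𝒜) : Finite (Abelian.Ext.{w} M K 0) :=
    Finite.of_equiv _ Abelian.Ext.addEquiv₀.symm.toEquiv
  have := h.epi
  rw [e, e, e]
  refine card_fiber_mul_of_exact ((Abelian.Ext.mk₀ q).precomp K (zero_add 0))
    ((Abelian.Ext.mk₀ j).precomp K (zero_add 0)) (h.shortExact.extClass.precomp K (add_zero 1))
    ((Abelian.Ext.mk₀ q).precomp K (zero_add 1)) ((Abelian.Ext.mk₀ j).precomp K (zero_add 1))
    (Abelian.Ext.precomp_mk₀_injective_of_epi K q) ?_ ?_ ?_ ?_ ?_ σ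
  · exact (ShortComplex.ab_exact_iff_function_exact _).1
      (Abelian.Ext.contravariant_sequence_exact₂' h.shortExact K 0)
  · exact (ShortComplex.ab_exact_iff_function_exact _).1
      (Abelian.Ext.contravariant_sequence_exact₁' h.shortExact K 0 1 rfl)
  · exact (ShortComplex.ab_exact_iff_function_exact _).1
      (Abelian.Ext.contravariant_sequence_exact₃' h.shortExact K 0 1 rfl)
  · exact (ShortComplex.ab_exact_iff_function_exact _).1
      (Abelian.Ext.contravariant_sequence_exact₂' h.shortExact K 1)
  -- Vanishing of `Ext²(Q, K)` makes restriction to `I` surjective, so no fibre is empty.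
  · intro σ
    exact Abelian.Ext.contravariant_sequence_exact₁ h.shortExact K σ (n₁ := 2) rfl
      (Subsingleton.elim _ _)

/-- The sum is the fibre size times `|Hom(I,K)| / |Hom(T,K)|`. By `card_ext_fiber` it depends
neither on the class of `h` nor on `T`. -/
theorem sum_card_completion {K S I T Q : 𝒜} [∀ M N : 𝒜, Finite (Abelian.Ext.{w} M N 1)]
    [Subsingleton (Abelian.Ext.{w} Q K 2)]
    {κ : K ⟶ S} {p : S ⟶ I} {j : I ⟶ T} {q : T ⟶ Q} (h : IsSES κ p) (h' : IsSES j q)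
    (𝒮 : Finset (IsoClass 𝒜)) (h𝒮 : ∀ C : 𝒜, Nonempty (Completion κ p j C) → ⟦C⟧ ∈ 𝒮) :
    ∑ C ∈ 𝒮, (Nat.card (Completion κ p j C.rep) : ℚ) / autCard C.rep =
      (Nat.card (Abelian.Ext.{w} Q K 1) : ℚ) / Nat.card (Q ⟶ K) := by
  have h₁ := sum_card_cls_mem.{w} (fun ω : Abelian.Ext.{w} T K 1 =>
    (Abelian.Ext.mk₀ j).comp ω (zero_add 1) = h.shortExact.extClass) 𝒮 (fun C s hs => h𝒮 C (by
      obtain ⟨m, hm, hm'⟩ := (h.exists_hom_iff s.2 j).2 hs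
      exact ⟨⟨(m, s.1.2), hm', by simpa only [hm] using s.2⟩⟩))
  have h₂ := card_ext_fiber.{w} K h' h.shortExact.extClass
  simp only [card_completion.{w} h, Nat.cast_mul, mul_div_right_comm]
  rw [← Finset.sum_mul, h₁]
  have pos (M : 𝒜) : (Nat.card (M ⟶ K) : ℚ) ≠ 0 := by exact_mod_cast Nat.card_pos.ne'
  have := pos Q
  have := pos T
  field_simp
  rw [mul_comm (Nat.card (T ⟶ K) : ℚ), mul_right_comm]
  exact_mod_cast h₂

end Completions

/-! ### Three by three diagrams: crosses, frames and their compatibility. -/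

section Crosses

attribute [local simp] pullback.lift_fst pullback.lift_snd pullback.lift_fst_assoc
  pullback.lift_snd_assoc pushout.inl_desc pushout.inr_desc pushout.inl_desc_assoc
  pushout.inr_desc_assoc

variable {𝒜 : Type u} [Category.{v} 𝒜] [Abelian 𝒜]

theorem exists_iso_of_epi_mono_factorizations {M N I I' : 𝒜} {e : M ⟶ I} {m : I ⟶ N}
    {e' : M ⟶ I'} {m' : I' ⟶ N} (he : Epi e) (hm : Mono m) (he' : Epi e') (hm' : Mono m')
    (h : e ≫ m = e' ≫ m') : ∃ φ : I ≅ I', e ≫ φ.hom = e' ∧ φ.inv ≫ m = m' := by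
  have : StrongEpi e := strongEpi_of_epi e
  have sq : CommSq e' e m' m := ⟨h.symm⟩
  have h₁ : e ≫ sq.lift = e' := sq.fac_left
  have h₂ : sq.lift ≫ m' = m := sq.fac_right
  have : Mono sq.lift := mono_of_mono_fac h₂
  have : Epi sq.lift := epi_of_epi_fac h₁
  have : IsIso sq.lift := isIso_of_mono_of_epi _
  exact ⟨asIso sq.lift, h₁, by rw [Iso.inv_comp_eq, asIso_hom, h₂]⟩

/-- The pairs of short exact sequences `B ⟶ C ⟶ A` and `B' ⟶ C ⟶ A'`. -/
abbrev Cross (A B A' B' C : 𝒜) : Type v := SES B C A × SES B' C A'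

/-- The perimeter of a three by three diagram with short exact rows and columns. -/
abbrev Frame (A B A' B' X Y X' Y' : 𝒜) : Type v :=
  (SES X' A X × SES Y' B Y) × (SES Y A' X × SES Y' B' X')

variable {A B A' B' : 𝒜}

namespace Frame

variable {X Y X' Y' : 𝒜} (F : Frame A B A' B' X Y X' Y')

abbrev a₁ : X' ⟶ A := F.1.1.1.1
abbrev a₂ : A ⟶ X := F.1.1.1.2
abbrev b₁ : Y' ⟶ B := F.1.2.1.1
abbrev b₂ : B ⟶ Y := F.1.2.1.2
abbrev a₁' : Y ⟶ A' := F.2.1.1.1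
abbrev a₂' : A' ⟶ X := F.2.1.1.2
abbrev b₁' : Y' ⟶ B' := F.2.2.1.1
abbrev b₂' : B' ⟶ X' := F.2.2.1.2

theorem isSES_a : IsSES F.a₁ F.a₂ := F.1.1.2
theorem isSES_b : IsSES F.b₁ F.b₂ := F.1.2.2
theorem isSES_a' : IsSES F.a₁' F.a₂' := F.2.1.2
theorem isSES_b' : IsSES F.b₁' F.b₂' := F.2.2.2

theorem ext {F G : Frame A B A' B' X Y X' Y'} (h₁ : F.a₁ = G.a₁) (h₂ : F.a₂ = G.a₂)
    (h₃ : F.b₁ = G.b₁) (h₄ : F.b₂ = G.b₂) (h₅ : F.a₁' = G.a₁') (h₆ : F.a₂' = G.a₂')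
    (h₇ : F.b₁' = G.b₁') (h₈ : F.b₂' = G.b₂') : F = G :=
  Prod.ext (Prod.ext (Subtype.ext (Prod.ext h₁ h₂)) (Subtype.ext (Prod.ext h₃ h₄)))
    (Prod.ext (Subtype.ext (Prod.ext h₅ h₆)) (Subtype.ext (Prod.ext h₇ h₈)))

/-- Transport of a frame along isomorphisms of its corners. -/
def map {X₁ Y₁ X₁' Y₁' : 𝒜} (x : X ≅ X₁) (y : Y ≅ Y₁) (x' : X' ≅ X₁') (y' : Y' ≅ Y₁') :
    Frame A B A' B' X₁ Y₁ X₁' Y₁' :=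
  ((⟨(x'.inv ≫ F.a₁, F.a₂ ≫ x.hom), by
      simpa using F.isSES_a.congr_iso x'.symm (Iso.refl _) x⟩,
    ⟨(y'.inv ≫ F.b₁, F.b₂ ≫ y.hom), by
      simpa using F.isSES_b.congr_iso y'.symm (Iso.refl _) y⟩),
   (⟨(y.inv ≫ F.a₁', F.a₂' ≫ x.hom), by
      simpa using F.isSES_a'.congr_iso y.symm (Iso.refl _) x⟩,
    ⟨(y'.inv ≫ F.b₁', F.b₂' ≫ x'.hom), by
      simpa using F.isSES_b'.congr_iso y'.symm (Iso.refl _) x'⟩))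

/-- `X'` and `Y` are the images of `B' ⟶ A` and `B ⟶ A'`; then `X` is a cokernel and `Y'` a kernel.
The edges `a₂'` and `b₁'` are not recovered without a cross. -/
theorem exists_isos {X₁ Y₁ X₁' Y₁' : 𝒜} (G : Frame A B A' B' X₁ Y₁ X₁' Y₁')
    (h : F.b₂' ≫ F.a₁ = G.b₂' ≫ G.a₁) (h' : F.b₂ ≫ F.a₁' = G.b₂ ≫ G.a₁') :
    ∃ (x : X ≅ X₁) (y : Y ≅ Y₁) (x' : X' ≅ X₁') (y' : Y' ≅ Y₁'),
      x'.inv ≫ F.a₁ = G.a₁ ∧ F.a₂ ≫ x.hom = G.a₂ ∧ y'.inv ≫ F.b₁ = G.b₁ ∧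
      F.b₂ ≫ y.hom = G.b₂ ∧ y.inv ≫ F.a₁' = G.a₁' ∧ F.b₂' ≫ x'.hom = G.b₂' := by
  obtain ⟨x', h₁, h₂⟩ := exists_iso_of_epi_mono_factorizations F.isSES_b'.epi F.isSES_a.mono
    G.isSES_b'.epi G.isSES_a.mono h
  obtain ⟨y, h₃, h₄⟩ := exists_iso_of_epi_mono_factorizations F.isSES_b.epi F.isSES_a'.mono
    G.isSES_b.epi G.isSES_a'.mono h'
  obtain ⟨x, hx⟩ := IsSES.exists_iso_right (i := G.a₁) (p := F.a₂)
    (by simpa [h₂] using F.isSES_a.congr_iso x'.symm (Iso.refl _) (Iso.refl _)) G.isSES_a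
  obtain ⟨y', hy'⟩ := IsSES.exists_iso_left (i := F.b₁) (p := G.b₂)
    (by simpa [h₃] using F.isSES_b.congr_iso (Iso.refl _) (Iso.refl _) y) G.isSES_b
  exact ⟨x, y, x', y'.symm, h₂, hx, hy', h₃, h₄, h₁⟩

end Frame

/-- The cross and the frame form a commutative three by three diagram. -/
structure Compat {C X Y X' Y' : 𝒜} (c : Cross A B A' B' C) (F : Frame A B A' B' X Y X' Y') :
    Prop where
  left_top : F.b₁ ≫ c.1.1.1 = F.b₁' ≫ c.2.1.1
  right_top : c.1.1.1 ≫ c.2.1.2 = F.b₂ ≫ F.a₁'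
  left_bot : c.2.1.1 ≫ c.1.1.2 = F.b₂' ≫ F.a₁
  right_bot : c.1.1.2 ≫ F.a₂ = c.2.1.2 ≫ F.a₂'

variable {C : 𝒜}

theorem Compat.map {X Y X' Y' X₁ Y₁ X₁' Y₁' : 𝒜} {c : Cross A B A' B' C}
    {F : Frame A B A' B' X Y X' Y'} (h : Compat c F)
    (x : X ≅ X₁) (y : Y ≅ Y₁) (x' : X' ≅ X₁') (y' : Y' ≅ Y₁') :
    Compat c (F.map x y x' y') where
  left_top := by
    change (y'.inv ≫ F.b₁) ≫ _ = (y'.inv ≫ F.b₁') ≫ _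
    simp only [Category.assoc, h.left_top]
  right_top := by
    change _ = (F.b₂ ≫ y.hom) ≫ y.inv ≫ F.a₁'
    simp [h.right_top]
  left_bot := by
    change _ = (F.b₂' ≫ x'.hom) ≫ x'.inv ≫ F.a₁
    simp [h.left_bot]
  right_bot := by
    change _ ≫ F.a₂ ≫ x.hom = _ ≫ F.a₂' ≫ x.hom
    simp only [reassoc_of% h.right_bot]

theorem Compat.exists_eq_map {X Y X' Y' X₁ Y₁ X₁' Y₁' : 𝒜} {c : Cross A B A' B' C}
    {F : Frame A B A' B' X Y X' Y'} {G : Frame A B A' B' X₁ Y₁ X₁' Y₁'}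
    (h : Compat c F) (h' : Compat c G) :
    ∃ (x : X ≅ X₁) (y : Y ≅ Y₁) (x' : X' ≅ X₁') (y' : Y' ≅ Y₁'), F.map x y x' y' = G := by
  obtain ⟨x, y, x', y', h₁, h₂, h₃, h₄, h₅, h₆⟩ := F.exists_isos G
    (h.left_bot.symm.trans h'.left_bot) (h.right_top.symm.trans h'.right_top)
  refine ⟨x, y, x', y', Frame.ext h₁ h₂ h₃ h₄ h₅ ?_ ?_ h₆⟩
  -- The two remaining edges are forced by the cross, whose `C ⟶ A'` is epi and `B' ⟶ C` is mono.
  · have := c.2.2.epi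
    rw [← cancel_epi c.2.1.2, ← h'.right_bot, ← h₂]
    exact (h.map x y x' y').right_bot.symm
  · have := c.2.2.mono
    rw [← cancel_mono c.2.1.1, ← h'.left_top, ← h₃]
    exact (h.map x y x' y').left_top.symm

theorem Compat.card {X Y X' Y' : 𝒜} {c : Cross A B A' B' C}
    {F : Frame A B A' B' X Y X' Y'} (h : Compat c F) (X₁ Y₁ X₁' Y₁' : 𝒜) :
    Nat.card {G : Frame A B A' B' X₁ Y₁ X₁' Y₁' // Compat c G} =
      Nat.card (X ≅ X₁) * Nat.card (Y ≅ Y₁) * Nat.card (X' ≅ X₁') * Nat.card (Y' ≅ Y₁') := by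
  rw [← Nat.card_prod, ← Nat.card_prod, ← Nat.card_prod]
  symm
  refine Nat.card_congr (Equiv.ofBijective
    (fun r => ⟨F.map r.1.1.1 r.1.1.2 r.1.2 r.2, h.map _ _ _ _⟩) ⟨?_, ?_⟩)
  · rintro ⟨⟨⟨x, y⟩, x'⟩, y'⟩ ⟨⟨⟨x₁, y₁⟩, x₁'⟩, y₁'⟩ e
    have e : F.map x y x' y' = F.map x₁ y₁ x₁' y₁' := congrArg Subtype.val e
    have e₁ : F.a₂ ≫ x.hom = F.a₂ ≫ x₁.hom := congrArg Frame.a₂ e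
    have e₂ : F.b₂ ≫ y.hom = F.b₂ ≫ y₁.hom := congrArg Frame.b₂ e
    have e₃ : F.b₂' ≫ x'.hom = F.b₂' ≫ x₁'.hom := congrArg Frame.b₂' e
    have e₄ : y'.inv ≫ F.b₁ = y₁'.inv ≫ F.b₁ := congrArg Frame.b₁ e
    have := F.isSES_a.epi
    have := F.isSES_b.epi
    have := F.isSES_b'.epi
    have := F.isSES_b.mono
    rw [cancel_epi] at e₁ e₂ e₃
    rw [cancel_mono] at e₄
    rw [Iso.ext e₁, Iso.ext e₂, Iso.ext e₃, Iso.ext_inv e₄]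
  · rintro ⟨G, hG⟩
    obtain ⟨x, y, x', y', rfl⟩ := h.exists_eq_map hG
    exact ⟨(((x, y), x'), y'), rfl⟩

/-- Every cross can be completed to a three by three diagram. -/
theorem Cross.exists_compat (c : Cross A B A' B' C) :
    ∃ (X Y X' Y' : 𝒜) (F : Frame A B A' B' X Y X' Y'), Compat c F := by
  obtain ⟨⟨⟨f, g⟩, h⟩, ⟨⟨f', g'⟩, h'⟩⟩ := c
  have hf := h.mono
  have hg := h.epi
  have hf' := h'.mono
  have hg' := h'.epi
  have hw := h.zero
  have hw' := h'.zero
  dsimp only at hf hg hf' hg' hw hw'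
  -- The corners are the images of `B ⟶ A'` and `B' ⟶ A`, the kernel of `B ⟶ Y` and the cokernel of
  -- `X' ⟶ A`.
  let b₂ := Abelian.factorThruImage (f ≫ g')
  let b₁ := kernel.ι b₂
  let a₁' := Abelian.image.ι (f ≫ g')
  have hba' : b₂ ≫ a₁' = f ≫ g' := Abelian.image.fac _
  let b₂' := Abelian.factorThruImage (f' ≫ g)
  let a₁ := Abelian.image.ι (f' ≫ g)
  have hb'a : b₂' ≫ a₁ = f' ≫ g := Abelian.image.fac _
  let a₂ := cokernel.π a₁
  have ha₂ : a₁ ≫ a₂ = 0 := cokernel.condition _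
  have hb₁ : b₁ ≫ b₂ = 0 := kernel.condition _
  obtain ⟨b₁', hb₁'⟩ := h'.exists_lift (b₁ ≫ f) (by
    simp [← hba', reassoc_of% hb₁])
  obtain ⟨a₂', ha₂'⟩ := h'.exists_desc (g ≫ a₂) (by
    simp [← reassoc_of% hb'a, ha₂])
  dsimp only at hb₁' ha₂'
  have : Epi a₂' := epi_of_epi_fac ha₂'
  have : Mono b₁' := mono_of_mono_fac hb₁'
  refine ⟨_, _, _, _, ((⟨(a₁, a₂), IsSES.kernel_cokernel a₁⟩, ⟨(b₁, b₂), ?_⟩),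
    (⟨(a₁', a₂'), ?_⟩, ⟨(b₁', b₂'), ?_⟩)), ⟨hb₁'.symm, hba'.symm, hb'a.symm, ha₂'.symm⟩⟩
  · exact IsSES.of_lift hb₁ fun t ht => ⟨kernel.lift _ t ht, kernel.lift_ι _ _ _⟩
  · refine IsSES.of_desc ?_ fun s hs => ?_
    · rw [← cancel_epi b₂, comp_zero, reassoc_of% hba', ha₂', reassoc_of% hw, zero_comp]
    · dsimp only at hs ⊢
      obtain ⟨s₁, hs₁⟩ := h.exists_desc (g' ≫ s) (by
        change f ≫ g' ≫ s = 0
        rw [← reassoc_of% hba', hs, comp_zero])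
      dsimp only at hs₁
      have h₁ : a₁ ≫ s₁ = 0 := by
        rw [← cancel_epi b₂', reassoc_of% hb'a, hs₁, reassoc_of% hw', zero_comp, comp_zero]
      exact ⟨cokernel.desc a₁ s₁ h₁, by
        rw [← cancel_epi g', reassoc_of% ha₂', cokernel.π_desc, hs₁]⟩
  · refine IsSES.of_lift ?_ fun t ht => ?_
    · rw [← cancel_mono a₁, zero_comp, Category.assoc, hb'a, reassoc_of% hb₁', hw, comp_zero]
    · dsimp only at ht ⊢
      obtain ⟨t₁, ht₁⟩ := h.exists_lift (t ≫ f') (by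
        change (t ≫ f') ≫ g = 0
        rw [Category.assoc, ← hb'a, reassoc_of% ht, zero_comp])
      dsimp only at ht₁
      have h₁ : t₁ ≫ b₂ = 0 := by
        rw [← cancel_mono a₁', Category.assoc, hba', reassoc_of% ht₁, hw', comp_zero, zero_comp]
      exact ⟨kernel.lift b₂ t₁ h₁, by
        rw [← cancel_mono f', Category.assoc, hb₁', kernel.lift_ι_assoc, ht₁]⟩

/-- If the diagonal `Y' ⟶ C ⟶ A ×_X A'` is short exact then so are the middle sequences. -/
theorem isSES_of_diagonal {X Y Y' : 𝒜} {b₁ : Y' ⟶ B} {b₂ : B ⟶ Y} {a₁' : Y ⟶ A'} {a₂' : A' ⟶ X}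
    {a₂ : A ⟶ X} {f : B ⟶ C} {g : C ⟶ A} {g' : C ⟶ A'} (hb : IsSES b₁ b₂) (ha' : IsSES a₁' a₂')
    (w : f ≫ g = 0) (h₁ : f ≫ g' = b₂ ≫ a₁') (h₂ : g ≫ a₂ = g' ≫ a₂') (h₃ : Mono (b₁ ≫ f))
    (h₄ : Epi g) (h₅ : ∀ {W : 𝒜} (t : W ⟶ C), t ≫ g = 0 → t ≫ g' = 0 → ∃ s, s ≫ b₁ ≫ f = t) :
    IsSES f g := by
  have := ha'.mono
  have := hb.epi
  have : Mono f := Preadditive.mono_of_cancel_zero _ fun t ht => by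
    obtain ⟨s, rfl⟩ := hb.exists_lift t (by
      rw [← cancel_mono a₁', zero_comp, Category.assoc, ← h₁, reassoc_of% ht, zero_comp])
    rw [Category.assoc] at ht
    rw [zero_of_comp_mono _ ht, zero_comp]
  refine IsSES.of_refinements w fun t ht => ?_
  obtain ⟨y, hy⟩ := ha'.exists_lift (t ≫ g') (by
    rw [Category.assoc, ← h₂, reassoc_of% ht, zero_comp])
  obtain ⟨V, π, hπ, s, hs⟩ := surjective_up_to_refinements_of_epi b₂ y
  -- After passing to a cover, subtracting an element of `B` kills the `A'` component; the rest
  -- comes from `Y'`.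
  obtain ⟨r, hr⟩ := h₅ (π ≫ t - s ≫ f) (by simp [ht, w])
    (by simp [h₁, ← hy, reassoc_of% hs])
  exact ⟨V, π, hπ, s + r ≫ b₁, by simp [hr]⟩

/-- For surjectivity, lift the `A` component through `g`. The error in `A'` lies in `Y`, hence is
corrected by an element of `B`, which `g` kills. -/
theorem isSES_diagonal {X Y Y' : 𝒜} {b₁ : Y' ⟶ B} {b₂ : B ⟶ Y} {a₁' : Y ⟶ A'} {a₂' : A' ⟶ X}
    {a₂ : A ⟶ X} {f : B ⟶ C} {g : C ⟶ A} {g' : C ⟶ A'} (hb : IsSES b₁ b₂) (ha' : IsSES a₁' a₂')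
    (h : IsSES f g) (h₁ : f ≫ g' = b₂ ≫ a₁') (h₂ : g ≫ a₂ = g' ≫ a₂') :
    IsSES (b₁ ≫ f) (pullback.lift g g' h₂) := by
  have := ha'.mono
  have := hb.epi
  have := hb.mono
  have := h.mono
  have := h.epi
  have : Epi (pullback.lift g g' h₂) := by
    rw [epi_iff_surjective_up_to_refinements]
    intro W t
    obtain ⟨V, π, hπ, c, hc⟩ := surjective_up_to_refinements_of_epi g (t ≫ pullback.fst _ _)
    obtain ⟨y, hy⟩ := ha'.exists_lift (c ≫ g' - π ≫ t ≫ pullback.snd _ _) (by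
      simp only [Preadditive.sub_comp, Category.assoc, ← h₂, ← reassoc_of% hc,
        pullback.condition, sub_self])
    obtain ⟨V', π', hπ', s, hs⟩ := surjective_up_to_refinements_of_epi b₂ y
    refine ⟨V', π' ≫ π, epi_comp _ _, π' ≫ c - s ≫ f, ?_⟩
    apply pullback.hom_ext
    · simp [h.zero, hc]
    · simp [h₁, ← reassoc_of% hs, hy]
  refine IsSES.of_lift ?_ fun t ht => ?_
  · apply pullback.hom_ext
    · simp [h.zero]
    · simp [h₁, reassoc_of% hb.zero]
  · have ht₁ : t ≫ g = 0 := by simpa using ht =≫ pullback.fst _ _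
    have ht₂ : t ≫ g' = 0 := by simpa using ht =≫ pullback.snd _ _
    obtain ⟨s, rfl⟩ := h.exists_lift t ht₁
    obtain ⟨r, rfl⟩ := hb.exists_lift s (by
      rw [← cancel_mono a₁', zero_comp, Category.assoc, ← h₁, ← ht₂, Category.assoc])
    exact ⟨r, by simp⟩

namespace Frame

variable {X Y X' Y' : 𝒜} (F : Frame A B A' B' X Y X' Y')

/-- The inclusion of the top left corner into the pushout of the adjacent objects. -/
noncomputable def topInclusion : Y' ⟶ pushout F.b₁ F.b₁' := F.b₁ ≫ pushout.inl _ _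

/-- The projection of the pushout at the top left corner to the off-diagonal corners. -/
noncomputable def topProjection : pushout F.b₁ F.b₁' ⟶ X' ⊞ Y :=
  pushout.desc (F.b₂ ≫ biprod.inr) (F.b₂' ≫ biprod.inl) (by
    rw [reassoc_of% F.isSES_b.zero, reassoc_of% F.isSES_b'.zero, zero_comp, zero_comp])

/-- The inclusion of the off-diagonal corners into the pullback at the bottom right corner. -/
noncomputable def botInclusion : X' ⊞ Y ⟶ pullback F.a₂ F.a₂' :=
  biprod.desc (pullback.lift F.a₁ 0 (by rw [F.isSES_a.zero, zero_comp]))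
    (pullback.lift 0 F.a₁' (by rw [F.isSES_a'.zero, zero_comp]))

/-- The projection of the pullback at the bottom right corner to that corner. -/
noncomputable def botProjection : pullback F.a₂ F.a₂' ⟶ X := pullback.fst _ _ ≫ F.a₂

theorem inl_topProjection : pushout.inl _ _ ≫ F.topProjection = F.b₂ ≫ biprod.inr :=
  pushout.inl_desc _ _ _

theorem inr_topProjection : pushout.inr _ _ ≫ F.topProjection = F.b₂' ≫ biprod.inl :=
  pushout.inr_desc _ _ _

theorem botInclusion_fst : F.botInclusion ≫ pullback.fst _ _ = biprod.fst ≫ F.a₁ := by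
  apply biprod.hom_ext' <;> simp [botInclusion]

theorem botInclusion_snd : F.botInclusion ≫ pullback.snd _ _ = biprod.snd ≫ F.a₁' := by
  apply biprod.hom_ext' <;> simp [botInclusion]

theorem isSES_top : IsSES F.topInclusion F.topProjection := by
  have := F.isSES_b.epi
  have := F.isSES_b'.epi
  have := F.isSES_b.mono
  have := F.isSES_b'.mono
  have : Mono F.topInclusion := mono_comp _ _
  have : Epi F.topProjection := Preadditive.epi_of_cancel_zero _ fun t ht => by
    apply biprod.hom_ext'
    · rw [← cancel_epi F.b₂', ← reassoc_of% F.inr_topProjection, ht, comp_zero, comp_zero, comp_zero]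
    · rw [← cancel_epi F.b₂, ← reassoc_of% F.inl_topProjection, ht, comp_zero, comp_zero, comp_zero]
  refine IsSES.of_desc ?_ fun t ht => ?_
  · rw [topInclusion, Category.assoc, F.inl_topProjection, reassoc_of% F.isSES_b.zero, zero_comp]
  · rw [topInclusion, Category.assoc] at ht
    obtain ⟨r, hr'⟩ := F.isSES_b.exists_desc _ ht
    obtain ⟨s, hs⟩ := F.isSES_b'.exists_desc (pushout.inr _ _ ≫ t) (by
      rw [← pushout.condition_assoc, ht])
    exact ⟨biprod.desc s r, pushout.hom_ext (by simp [reassoc_of% F.inl_topProjection, hr'])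
      (by simp [reassoc_of% F.inr_topProjection, hs])⟩

theorem isSES_bot : IsSES F.botInclusion F.botProjection := by
  have := F.isSES_a.epi
  have := F.isSES_a'.epi
  have := F.isSES_a.mono
  have := F.isSES_a'.mono
  have : Epi F.botProjection := epi_comp _ _
  have : Mono F.botInclusion := Preadditive.mono_of_cancel_zero _ fun t ht => by
    apply biprod.hom_ext
    · rw [← cancel_mono F.a₁, Category.assoc, ← F.botInclusion_fst, reassoc_of% ht, zero_comp, zero_comp, zero_comp]
    · rw [← cancel_mono F.a₁', Category.assoc, ← F.botInclusion_snd, reassoc_of% ht, zero_comp, zero_comp,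
        zero_comp]
  refine IsSES.of_lift ?_ fun t ht => ?_
  · rw [botProjection, reassoc_of% F.botInclusion_fst, F.isSES_a.zero, comp_zero]
  · rw [botProjection] at ht
    obtain ⟨r, hr'⟩ := F.isSES_a.exists_lift (t ≫ pullback.fst _ _) (by simpa using ht)
    obtain ⟨s, hs⟩ := F.isSES_a'.exists_lift (t ≫ pullback.snd _ _) (by
      rw [Category.assoc, ← pullback.condition, ht])
    exact ⟨biprod.lift r s, pullback.hom_ext (by simp [F.botInclusion_fst, hr']) (by simp [F.botInclusion_snd, hs])⟩

/-- Two corner squares of the diagram say that the maps glue to `S ⟶ C` and `C ⟶ T`. The other two,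
with the vanishing of both composites in the cross, are the four components of the factorization
equation. Exactness passes through the diagonal. -/
theorem card_compat (C : 𝒜) :
    Nat.card {c : Cross A B A' B' C // Compat c F} =
      Nat.card (Completion F.topInclusion F.topProjection F.botInclusion C) := by
  refine Nat.card_congr (Equiv.ofBijective
    (fun c => ⟨(pushout.desc c.1.1.1.1 c.1.2.1.1 c.2.left_top,
      pullback.lift c.1.1.1.2 c.1.2.1.2 c.2.right_bot), ?_, ?_⟩) ⟨?_, ?_⟩)
  · obtain ⟨⟨⟨⟨f, g⟩, h⟩, ⟨⟨f', g'⟩, h'⟩⟩, hc⟩ := c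
    have h₁ := hc.right_top
    have h₂ := hc.left_bot
    have hw := h.zero
    have hw' := h'.zero
    dsimp only at h₁ h₂ hw hw' ⊢
    apply pushout.hom_ext <;> apply pullback.hom_ext <;>
      simp [F.botInclusion_fst, F.botInclusion_snd, reassoc_of% F.inl_topProjection, reassoc_of% F.inr_topProjection, h₁, h₂, hw, hw']
  · have := isSES_diagonal F.isSES_b F.isSES_a' c.1.1.2 c.2.right_top c.2.right_bot
    simpa [topInclusion] using this
  · rintro ⟨⟨⟨⟨f, g⟩, h⟩, ⟨⟨f', g'⟩, h'⟩⟩, hc⟩ ⟨⟨⟨⟨f₁, g₁⟩, h₁⟩, ⟨⟨f₁', g₁'⟩, h₁'⟩⟩, hc₁⟩ e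
    have e₁ := congrArg (fun x : Completion F.topInclusion F.topProjection F.botInclusion C =>
      x.1.1) e
    have e₂ := congrArg (fun x : Completion F.topInclusion F.topProjection F.botInclusion C =>
      x.1.2) e
    obtain rfl : f = f₁ := by simpa using pushout.inl _ _ ≫= e₁
    obtain rfl : f' = f₁' := by simpa using pushout.inr _ _ ≫= e₁
    obtain rfl : g = g₁ := by simpa using e₂ =≫ pullback.fst _ _
    obtain rfl : g' = g₁' := by simpa using e₂ =≫ pullback.snd _ _
    rfl
  · rintro ⟨⟨m, e⟩, hm, hs⟩
    dsimp only at hm hs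
    have := F.isSES_a.epi
    have := F.isSES_a'.epi
    have he := hs.epi
    have hl := hs.mono
    rw [topInclusion, Category.assoc] at hl
    have hr : Mono (F.b₁' ≫ pushout.inr _ _ ≫ m) := by
      rwa [← pushout.condition_assoc]
    have hfg : (pushout.inl _ _ ≫ m) ≫ e ≫ pullback.fst _ _ = 0 := by
      simp [reassoc_of% hm, F.botInclusion_fst, reassoc_of% F.inl_topProjection]
    have hfg' : (pushout.inr _ _ ≫ m) ≫ e ≫ pullback.snd _ _ = 0 := by
      simp [reassoc_of% hm, F.botInclusion_snd, reassoc_of% F.inr_topProjection]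
    have h₁ : (pushout.inl _ _ ≫ m) ≫ e ≫ pullback.snd _ _ = F.b₂ ≫ F.a₁' := by
      simp [reassoc_of% hm, F.botInclusion_snd, reassoc_of% F.inl_topProjection]
    have h₂ : (pushout.inr _ _ ≫ m) ≫ e ≫ pullback.fst _ _ = F.b₂' ≫ F.a₁ := by
      simp [reassoc_of% hm, F.botInclusion_fst, reassoc_of% F.inr_topProjection]
    have h₃ : (e ≫ pullback.fst _ _) ≫ F.a₂ = (e ≫ pullback.snd _ _) ≫ F.a₂' := by
      simp [pullback.condition]
    have hlift {W : 𝒜} (t : W ⟶ C) (h : t ≫ e ≫ pullback.fst _ _ = 0)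
        (h' : t ≫ e ≫ pullback.snd _ _ = 0) :
        ∃ s, s ≫ F.b₁ ≫ pushout.inl _ _ ≫ m = t := by
      obtain ⟨s, hs'⟩ := hs.exists_lift t (pullback.hom_ext (by simpa using h) (by simpa using h'))
      exact ⟨s, by simpa [topInclusion] using hs'⟩
    refine ⟨⟨(⟨(pushout.inl _ _ ≫ m, e ≫ pullback.fst _ _), ?_⟩,
      ⟨(pushout.inr _ _ ≫ m, e ≫ pullback.snd _ _), ?_⟩), ⟨?_, h₁, h₂, h₃⟩⟩, ?_⟩
    · exact isSES_of_diagonal F.isSES_b F.isSES_a' hfg h₁ h₃ hl (epi_comp _ _) hlift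
    · refine isSES_of_diagonal F.isSES_b' F.isSES_a hfg' h₂ h₃.symm hr (epi_comp _ _) ?_
      intro W t h h'
      rw [← pushout.condition_assoc]
      exact hlift t h' h
    · exact pushout.condition_assoc _
    · exact Subtype.ext (Prod.ext (pushout.hom_ext (by simp) (by simp))
        (pullback.hom_ext (by simp) (by simp)))

end Frame

end Crosses

/-! ### Finiteness and the weighted double count. -/

section Green

variable {𝒜 : Type u} [Category.{v} 𝒜] [Abelian 𝒜]

/-- Quadruples of isomorphism classes, the possible corners of a frame. -/
abbrev Corners (𝒜 : Type u) [Category.{v} 𝒜] : Type u :=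
  IsoClass 𝒜 × IsoClass 𝒜 × IsoClass 𝒜 × IsoClass 𝒜

/-- The frames on the chosen representatives of the corners. -/
abbrev Corners.Frames (A B A' B' : 𝒜) (q : Corners 𝒜) : Type v :=
  Frame A B A' B' q.1.rep q.2.1.rep q.2.2.1.rep q.2.2.2.rep

/-- The product of the orders of the automorphism groups of the corners. -/
noncomputable def Corners.autCard (q : Corners 𝒜) : ℕ :=
  HallAlgebra.autCard q.1.rep * HallAlgebra.autCard q.2.1.rep *
    HallAlgebra.autCard q.2.2.1.rep * HallAlgebra.autCard q.2.2.2.rep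

omit [Abelian 𝒜] in
theorem Corners.eq_of_iso {q r : Corners 𝒜} (x : q.1.rep ≅ r.1.rep) (y : q.2.1.rep ≅ r.2.1.rep)
    (x' : q.2.2.1.rep ≅ r.2.2.1.rep) (y' : q.2.2.2.rep ≅ r.2.2.2.rep) : q = r := by
  have key {c d : IsoClass 𝒜} (φ : c.rep ≅ d.rep) : c = d :=
    (Quotient.out_eq c).symm.trans (IsoClass.mk_eq d φ)
  exact Prod.ext (key x) (Prod.ext (key y) (Prod.ext (key x') (key y')))

variable {A B A' B' : 𝒜}

theorem IsoClass.eq_of_cls_eq [HasExt.{w} 𝒜] {c d : IsoClass 𝒜} (s : SES B c.rep A)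
    (t : SES B d.rep A) (h : SES.cls.{w} s = t.cls) : c = d := by
  obtain ⟨m, hm, hm'⟩ := (s.2.exists_hom_iff t.2 (𝟙 A)).2 (by
    rw [Abelian.Ext.mk₀_id_comp]
    exact h.symm)
  have := s.2.isIso_of_comp t.2 m hm (by simpa using hm')
  exact (Quotient.out_eq c).symm.trans (IsoClass.mk_eq d (asIso m))

theorem finite_extensions [HasExt.{w} 𝒜] (A B : 𝒜) [Finite (Abelian.Ext.{w} A B 1)] :
    {c : IsoClass 𝒜 | Nonempty (SES B c.rep A)}.Finite := by
  rw [← Set.finite_coe_iff]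
  exact Finite.of_injective (fun c => SES.cls.{w} c.2.some) fun c d h =>
    Subtype.ext (IsoClass.eq_of_cls_eq _ _ h)

variable [∀ M N : 𝒜, Finite (M ⟶ N)]

/-- The composites `B' ⟶ A` and `B ⟶ A'` determine the corners up to isomorphism, and they range
over finite sets. -/
theorem finite_corners (A B A' B' : 𝒜) :
    {q : Corners 𝒜 | Nonempty (q.Frames A B A' B')}.Finite := by
  rw [← Set.finite_coe_iff]
  refine Finite.of_injective
    (fun q => ((q.2.some.b₂' ≫ q.2.some.a₁, q.2.some.b₂ ≫ q.2.some.a₁') :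
      (B' ⟶ A) × (B ⟶ A'))) fun q r h => ?_
  obtain ⟨x, y, x', y', -⟩ := q.2.some.exists_isos r.2.some (congrArg Prod.fst h)
    (congrArg Prod.snd h)
  exact Subtype.ext (Corners.eq_of_iso x y x' y')

omit [Abelian 𝒜] in
theorem Corners.autCard_ne_zero (q : Corners 𝒜) : (q.autCard : ℚ) ≠ 0 := by
  have (M : 𝒜) := (autCard_pos M).ne'
  simp [Corners.autCard, this]

/-- A cross lies in essentially one three by three diagram. -/
theorem Cross.sum_card_compat {C : 𝒜} (c : Cross A B A' B' C) (𝒬 : Finset (Corners 𝒜))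
    (h𝒬 : ∀ q : Corners 𝒜, Nonempty (q.Frames A B A' B') → q ∈ 𝒬) :
    ∑ q ∈ 𝒬, (Nat.card {F : q.Frames A B A' B' // Compat c F} : ℚ) / q.autCard = 1 := by
  obtain ⟨X, Y, X', Y', F, hF⟩ := c.exists_compat
  set q₀ : Corners 𝒜 := (⟦X⟧, ⟦Y⟧, ⟦X'⟧, ⟦Y'⟧)
  obtain ⟨x⟩ : Nonempty (q₀.1.rep ≅ X) := IsoClass.nonempty_rep_iso X
  obtain ⟨y⟩ : Nonempty (q₀.2.1.rep ≅ Y) := IsoClass.nonempty_rep_iso Y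
  obtain ⟨x'⟩ : Nonempty (q₀.2.2.1.rep ≅ X') := IsoClass.nonempty_rep_iso X'
  obtain ⟨y'⟩ : Nonempty (q₀.2.2.2.rep ≅ Y') := IsoClass.nonempty_rep_iso Y'
  -- With the frame moved onto the representatives, the count in `Compat.card` is `q₀.autCard` by
  -- definition.
  have hG : Compat c (F.map x.symm y.symm x'.symm y'.symm) := hF.map _ _ _ _
  rw [Finset.sum_eq_single q₀]
  · rw [hG.card]
    exact div_self q₀.autCard_ne_zero
  · intro q _ hq
    have : IsEmpty {F : q.Frames A B A' B' // Compat c F} := ⟨fun G => by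
      obtain ⟨x, y, x', y', -⟩ := hG.exists_eq_map G.2
      exact hq (Corners.eq_of_iso x y x' y').symm⟩
    simp
  · exact fun h => (h (h𝒬 _ ⟨F.map x.symm y.symm x'.symm y'.symm⟩)).elim

variable [HasExt.{w} 𝒜] [∀ M N : 𝒜, Finite (Abelian.Ext.{w} M N 1)] [Hereditary.{w} 𝒜]

/-- The weighted count of the completions of a frame to a three by three diagram. -/
theorem Frame.sum_card_compat {X Y X' Y' : 𝒜} (F : Frame A B A' B' X Y X' Y')
    (𝒮 : Finset (IsoClass 𝒜)) (h𝒮 : ∀ c : IsoClass 𝒜, Nonempty (SES B c.rep A) → c ∈ 𝒮) :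
    ∑ C ∈ 𝒮, (Nat.card {c : Cross A B A' B' C.rep // Compat c F} : ℚ) / HallAlgebra.autCard C.rep =
      (Nat.card (Abelian.Ext.{w} X Y' 1) : ℚ) / Nat.card (X ⟶ Y') := by
  have := Hereditary.ext_subsingleton.{w} X Y' 2 le_rfl
  simp only [F.card_compat]
  refine sum_card_completion.{w} F.isSES_top F.isSES_bot 𝒮 fun C hC => h𝒮 _ ?_
  have : Finite (Completion F.topInclusion F.topProjection F.botInclusion C) :=
    inferInstanceAs (Finite (Subtype _))
  have hpos := Nat.card_pos (α := Completion F.topInclusion F.topProjection F.botInclusion C)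
  rw [← F.card_compat] at hpos
  obtain ⟨⟨c, -⟩⟩ := (Nat.card_pos_iff.1 hpos).1
  obtain ⟨φ⟩ := IsoClass.nonempty_rep_iso C
  exact ⟨⟨(_, _), c.1.2.congr_iso (Iso.refl _) φ.symm (Iso.refl _)⟩⟩

/-- Compatible pairs, weighted by `1 / (a_C · q.autCard)`, are summed first over frames, giving one
per cross, and then over crosses, giving the `Ext`–`Hom` ratio per frame. -/
theorem sum_card_cross (𝒮 : Finset (IsoClass 𝒜))
    (h𝒮 : ∀ c : IsoClass 𝒜, Nonempty (SES B c.rep A) → c ∈ 𝒮) (𝒬 : Finset (Corners 𝒜))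
    (h𝒬 : ∀ q : Corners 𝒜, Nonempty (q.Frames A B A' B') → q ∈ 𝒬) :
    ∑ C ∈ 𝒮, (Nat.card (Cross A B A' B' C.rep) : ℚ) / autCard C.rep =
      ∑ q ∈ 𝒬, (Nat.card (Abelian.Ext.{w} q.1.rep q.2.2.2.rep 1) : ℚ) /
        Nat.card (q.1.rep ⟶ q.2.2.2.rep) * Nat.card (q.Frames A B A' B') / q.autCard := by
  have (C : 𝒜) := Fintype.ofFinite (Cross A B A' B' C)
  have (q : Corners 𝒜) := Fintype.ofFinite (q.Frames A B A' B')
  have hswap (C : 𝒜) (q : Corners 𝒜) :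
      ∑ c : Cross A B A' B' C, (Nat.card {F : q.Frames A B A' B' // Compat c F} : ℚ) =
        ∑ F : q.Frames A B A' B', (Nat.card {c : Cross A B A' B' C // Compat c F} : ℚ) := by
    rw [← Nat.cast_sum, ← Nat.cast_sum, ← Nat.card_sigma, ← Nat.card_sigma]
    exact congrArg _ (Nat.card_congr
      ⟨fun x => ⟨x.2.1, x.1, x.2.2⟩, fun x => ⟨x.2.1, x.1, x.2.2⟩, fun _ => rfl, fun _ => rfl⟩)
  have h₁ (C : 𝒜) : (Nat.card (Cross A B A' B' C) : ℚ) =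
      ∑ q ∈ 𝒬, (∑ F : q.Frames A B A' B',
        (Nat.card {c : Cross A B A' B' C // Compat c F} : ℚ)) / q.autCard := by
    simp only [← hswap, Finset.sum_div]
    rw [Finset.sum_comm, Finset.sum_congr rfl fun c _ => c.sum_card_compat 𝒬 h𝒬]
    simp
  simp only [h₁, Finset.sum_div]
  rw [Finset.sum_comm]
  refine Finset.sum_congr rfl fun q _ => ?_
  rw [Finset.sum_comm]
  simp only [div_right_comm _ (q.autCard : ℚ), ← Finset.sum_div]
  rw [Finset.sum_congr rfl fun F _ => F.sum_card_compat 𝒮 h𝒮]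
  simp [mul_comm]

omit [HasExt.{w} 𝒜] [∀ M N : 𝒜, Finite (Abelian.Ext.{w} M N 1)] [Hereditary.{w} 𝒜]
  [∀ M N : 𝒜, Finite (M ⟶ N)] in
theorem mul_greenLeftTerm (A B A' B' C : 𝒜) :
    (autCard A : ℚ) * autCard B * autCard A' * autCard B' * greenLeftTerm A B A' B' C =
      (Nat.card (Cross A B A' B' C) : ℚ) / autCard C := by
  rw [Nat.card_prod, card_ses, card_ses, greenLeftTerm]
  push_cast
  ring

omit [∀ M N : 𝒜, Finite (Abelian.Ext.{w} M N 1)] [Hereditary.{w} 𝒜] in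
-- Each corner lies on two of the four sequences, so `card_ses` gives its automorphism order twice;
-- dividing by `q.autCard` leaves one.
theorem greenRightTerm_eq (A B A' B' : 𝒜) (q : Corners 𝒜) :
    greenRightTerm.{w} A B A' B' q.1.rep q.2.1.rep q.2.2.1.rep q.2.2.2.rep =
      (Nat.card (Abelian.Ext.{w} q.1.rep q.2.2.2.rep 1) : ℚ) /
        Nat.card (q.1.rep ⟶ q.2.2.2.rep) * Nat.card (q.Frames A B A' B') / q.autCard := by
  rw [eq_div_iff q.autCard_ne_zero, Nat.card_prod, Nat.card_prod, Nat.card_prod, card_ses,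
    card_ses, card_ses, card_ses, greenRightTerm, Corners.autCard]
  push_cast
  ring

end Green
end HallAlgebra

open HallAlgebra

theorem theorem4p1 {k : Type*} [Field k] [Finite k]
    {𝒜 : Type u} [Category.{v} 𝒜] [EssentiallySmall.{w₀} 𝒜] [Abelian 𝒜] [Linear k 𝒜]
    [HasExt.{w} 𝒜] [HallAlgebra.Finitary.{w} k 𝒜] [HallAlgebra.Hereditary.{w} 𝒜]
    (A B A' B' : 𝒜) :
    (Function.support fun C : HallAlgebra.IsoClass 𝒜 =>
        HallAlgebra.greenLeftTerm A B A' B' C.rep).Finite ∧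
    (Function.support fun p : HallAlgebra.IsoClass 𝒜 × HallAlgebra.IsoClass 𝒜 ×
          HallAlgebra.IsoClass 𝒜 × HallAlgebra.IsoClass 𝒜 =>
        HallAlgebra.greenRightTerm.{w} A B A' B'
          p.1.rep p.2.1.rep p.2.2.1.rep p.2.2.2.rep).Finite ∧
    (HallAlgebra.autCard A : ℚ) * (HallAlgebra.autCard B : ℚ) *
        (HallAlgebra.autCard A' : ℚ) * (HallAlgebra.autCard B' : ℚ) *
        ∑ᶠ C : HallAlgebra.IsoClass 𝒜, HallAlgebra.greenLeftTerm A B A' B' C.rep =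
      ∑ᶠ p : HallAlgebra.IsoClass 𝒜 × HallAlgebra.IsoClass 𝒜 ×
          HallAlgebra.IsoClass 𝒜 × HallAlgebra.IsoClass 𝒜,
        HallAlgebra.greenRightTerm.{w} A B A' B'
          p.1.rep p.2.1.rep p.2.2.1.rep p.2.2.2.rep := by
  have (M N : 𝒜) : Finite (M ⟶ N) :=
    have := Finitary.finite_hom (k := k) M N
    Module.finite_of_finite k
  have (M N : 𝒜) : Finite (Abelian.Ext.{w} M N 1) :=
    have := Finitary.finite_ext (k := k) M N
    Module.finite_of_finite k
  -- These finite sets contain the supports of the two sums and turn them into finite sums.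
  have hS := finite_extensions.{w} A B
  have hQ := finite_corners A B A' B'
  have hl : (Function.support fun C : IsoClass 𝒜 => greenLeftTerm A B A' B' C.rep) ⊆
      hS.toFinset := by
    intro C hC
    have h : hallNumber A B C.rep ≠ 0 := fun h => hC (by simp [greenLeftTerm, h])
    have hpos : 0 < Nat.card (SES B C.rep A) := by
      rw [card_ses]
      exact Nat.mul_pos (Nat.pos_of_ne_zero h) (Nat.mul_pos (autCard_pos A) (autCard_pos B))
    simpa using (Nat.card_pos_iff.1 hpos).1
  have hr : (Function.support fun q : Corners 𝒜 =>
      greenRightTerm.{w} A B A' B' q.1.rep q.2.1.rep q.2.2.1.rep q.2.2.2.rep) ⊆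
      hQ.toFinset := by
    intro q hq
    rw [Function.mem_support, greenRightTerm_eq] at hq
    have h : Nat.card (q.Frames A B A' B') ≠ 0 := fun h => hq (by rw [h]; simp)
    simpa using (Nat.card_pos_iff.1 (Nat.pos_of_ne_zero h)).1
  refine ⟨hS.toFinset.finite_toSet.subset hl, hQ.toFinset.finite_toSet.subset hr, ?_⟩
  rw [finsum_eq_sum_of_support_subset _ hl, finsum_eq_sum_of_support_subset _ hr, Finset.mul_sum,
    Finset.sum_congr rfl fun C _ => mul_greenLeftTerm A B A' B' C.rep,
    Finset.sum_congr rfl fun q _ => greenRightTerm_eq A B A' B' q]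
  exact sum_card_cross.{w} _ (fun c hc => by simpa using hc) _ (fun q hq => by simpa using hq)
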